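/- A lattice equable parallelogram (LEP) is a nondegenerate parallelogram in the Euclidean plane whose vertices lie on $\mathbb Z^2$ and whose perimeter equals its area. A LEP $P$ is called Pythagorean if there is a rectangle $R$ (not necessarily with sides parallel to the axes) with integer side lengths such that every vertex of $P$ lies on a side of $R$, and $P$ and $R$ have a common diagonal ($R=P$ is allowed). **Theorem.** If a Pythagorean LEP has side lengths $a\le b$, then $a\in\{3,4,5,6,10\}$. Moreover, real numbers $a\le b$ are the side lengths of a Pythagorean LEP if and only if $(a,b)$ belongs to one of the following five families, where $x,y$ are integers: - (F1) $a=3$, $b=\frac{3(x^2+y^2)}{2}$, where $y^2-5x^2=4$; - (F2) $a=4$, $b=4(x^2+y^2)$, where $y^2-3x^2=1$; - (F3) $a=5$, $b=\frac{x^2+y^2}{2}$, where $3y^2-7x^2=20$; - (F4) $a=6$, $b=3(x^2+y^2)$, where $y^2-2x^2=1$; - (F5) $a=10$, $b=x^2+y^2$, where $2y^2-3x^2=5$. Every integer solution $(x,y)$ of each of these equations gives a pair $(a,b)$ of side lengths of a Pythagorean LEP (where $a>b$ can occur: the smallest solutions in (F4) and (F5) give $(6,3)$ and $(10,5)$), and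 each of the five families contains infinitely many pairs $(a,b)$ with $a\le b$. -/

import Mathlib

/-- The Euclidean plane. -/
abbrev Plane : Type := EuclideanSpace ℝ (Fin 2)

/-- `P 0, P 1, P 2, P 3` are, in cyclic order, the vertices of a (nondegenerate) parallelogram.
Indices in `Fin 4` are read modulo `4`. -/
def IsParallelogram (P : Fin 4 → Plane) : Prop :=
  P 1 - P 0 = P 2 - P 3 ∧ LinearIndependent ℝ ![P 1 - P 0, P 3 - P 0]

/-- A rectangle: a parallelogram with a right angle. -/
def IsRectangle (R : Fin 4 → Plane) : Prop :=
  IsParallelogram R ∧ inner ℝ (R 1 - R 0) (R 3 - R 0) = 0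

/-- The perimeter of the quadrilateral with the given vertices in cyclic order. -/
noncomputable def perimeter (P : Fin 4 → Plane) : ℝ :=
  ∑ i, dist (P i) (P (i + 1))

/-- The area (Lebesgue measure) of the convex quadrilateral with the given vertices. -/
noncomputable def area (P : Fin 4 → Plane) : ℝ :=
  MeasureTheory.volume.real (convexHull ℝ (Set.range P))

/-- A lattice equable parallelogram (LEP): a parallelogram whose perimeter equals its area and
whose vertices lie on the integer lattice. -/
def IsLEP (P : Fin 4 → Plane) : Prop :=
  IsParallelogram P ∧ (∀ i j, ∃ n : ℤ, P i j = n) ∧ perimeter P = area P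

/-- The rectangle (or quadrilateral) `R` circumscribes `P`: every vertex of `P` lies on a side
of `R`. -/
def Circumscribes (R P : Fin 4 → Plane) : Prop :=
  ∀ i, ∃ j, P i ∈ segment ℝ (R j) (R (j + 1))

/-- `R` and `P` have a diagonal in common. -/
def ShareDiagonal (R P : Fin 4 → Plane) : Prop :=
  ∃ i j, P i = R j ∧ P (i + 2) = R (j + 2)

/-- A Pythagorean equable parallelogram: a LEP circumscribed by a rectangle (in any position)
having integer side lengths, so that the rectangle and the parallelogram share a diagonal. -/
def IsPythagoreanLEP (P : Fin 4 → Plane) : Prop :=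
  IsLEP P ∧ ∃ R : Fin 4 → Plane, IsRectangle R ∧
    (∀ j, ∃ n : ℤ, dist (R j) (R (j + 1)) = n) ∧ Circumscribes R P ∧ ShareDiagonal R P

/-- The (unordered) pair of side lengths of the parallelogram `P` is `a, b`. -/
def HasSides (P : Fin 4 → Plane) (a b : ℝ) : Prop :=
  (dist (P 0) (P 1) = a ∧ dist (P 1) (P 2) = b) ∨
    (dist (P 0) (P 1) = b ∧ dist (P 1) (P 2) = a)

/-- The pairs `(a, b)` that are the side lengths, in some order, of a Pythagorean equable
parallelogram. -/
def pythagoreanSides : Set (ℝ × ℝ) :=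
  {p | ∃ P : Fin 4 → Plane, IsPythagoreanLEP P ∧ HasSides P p.1 p.2}

def family1 : Set (ℝ × ℝ) :=
  {p | ∃ x y : ℤ, y ^ 2 - 5 * x ^ 2 = 4 ∧ p.1 = 3 ∧ p.2 = 3 * ((x : ℝ) ^ 2 + (y : ℝ) ^ 2) / 2}

def family2 : Set (ℝ × ℝ) :=
  {p | ∃ x y : ℤ, y ^ 2 - 3 * x ^ 2 = 1 ∧ p.1 = 4 ∧ p.2 = 4 * ((x : ℝ) ^ 2 + (y : ℝ) ^ 2)}

def family3 : Set (ℝ × ℝ) :=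
  {p | ∃ x y : ℤ, 3 * y ^ 2 - 7 * x ^ 2 = 20 ∧ p.1 = 5 ∧ p.2 = ((x : ℝ) ^ 2 + (y : ℝ) ^ 2) / 2}

def family4 : Set (ℝ × ℝ) :=
  {p | ∃ x y : ℤ, y ^ 2 - 2 * x ^ 2 = 1 ∧ p.1 = 6 ∧ p.2 = 3 * ((x : ℝ) ^ 2 + (y : ℝ) ^ 2)}

def family5 : Set (ℝ × ℝ) :=
  {p | ∃ x y : ℤ, 2 * y ^ 2 - 3 * x ^ 2 = 5 ∧ p.1 = 10 ∧ p.2 = (x : ℝ) ^ 2 + (y : ℝ) ^ 2}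

/-! Since `P` and `R` share a diagonal, a further vertex of `P` on a side of `R` forces one pair of
sides of `P` to run along sides of `R` (`isTriplePair_of_mem_side`). Let `t` be the length of these
sides, `c` that of the other two, `h` the side of `R` perpendicular to `t`, and `s` the offset. Then
`s² + h² = c²`, and equability reads `t h = 2 (t + c)`; all these quantities are integers.
Conversely, such data give a parallelogram in an axis-parallel rectangle.

Eliminating `c` gives `((t - 2) h - 2 t) ((t + 2) h - 2 t) = (2 s)²`, so the factors are `g X²` and
`g Y²`. With `p = Y - X` and `q = Y + X` this becomes the Markov-type equation `g (t p q - p² - q²)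
= 8 t`. Vieta jumping reduces it to finitely many `(t, g)` (`reducedPair_of_solution`), and 2-adic
congruences leave only the five Pell-type families. If `t` is the longer side, then `h ≤ 4` and a
finite check suffices. Infinitude comes from the automorphs of the Pell forms. -/

/-! ### Vieta descent for the quadratic equation -/

/-- The pairs `(t, d)` for which `d (t p q - p² - q²) = 8 t` has a reduced positive solution. -/
def ReducedPair (t d : ℤ) : Prop :=
  (t = 3 ∧ (d = 6 ∨ d = 24)) ∨ (t = 4 ∧ (d = 1 ∨ d = 4 ∨ d = 16)) ∨ (t = 5 ∧ (d = 2 ∨ d = 8)) ∨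
    (t = 6 ∧ (d = 3 ∨ d = 6 ∨ d = 12)) ∨ (t = 10 ∧ (d = 1 ∨ d = 4 ∨ d = 10)) ∨
    (t = 18 ∧ (d = 1 ∨ d = 9)) ∨ (t = 26 ∧ d = 2) ∨ (t = 30 ∧ d = 3) ∨ (t = 34 ∧ d = 1) ∨
    (t = 82 ∧ d = 1)

/-- On `p ≤ q ≤ t p / 2` the form `t p q - p² - q²` increases in `q`, so its value is at least that
at `q = p`. This bounds `d` and `p`; eliminating `t` then bounds `q`, and a finite search remains.
-/
theorem reducedPair_of_reduced {t d p q : ℤ} (ht : 3 ≤ t) (hd : 0 < d) (hp : 0 < p) (hpq : p ≤ q)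
    (hq : 2 * q ≤ t * p) (h : d * (t * p * q - p ^ 2 - q ^ 2) = 8 * t) : ReducedPair t d := by
  have h0 : (t - 2) * p ^ 2 ≤ t * p * q - p ^ 2 - q ^ 2 := by
    nlinarith [mul_nonneg (sub_nonneg.2 hpq) (by nlinarith : 0 ≤ t * p - p - q)]
  have h1 : d * ((t - 2) * p ^ 2) ≤ 8 * t := h ▸ mul_le_mul_of_nonneg_left h0 hd.le
  -- `8 t / (t - 2)` is largest at `t = 3`, where it equals 24.
  have h2 : d * p ^ 2 ≤ 24 := by
    by_contra! hc
    nlinarith [mul_le_mul_of_nonneg_left (show 25 ≤ d * p ^ 2 by linarith)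
      (show 0 ≤ t - 2 by linarith)]
  have hp4 : p ≤ 4 := by
    by_contra! hc
    nlinarith
  have hd24 : d ≤ 24 := by nlinarith
  have hk : d * (p ^ 2 + q ^ 2) = t * (d * p * q - 8) := by linear_combination -h
  have hk0 : 0 < d * p * q - 8 := by
    have : 0 < d * (p ^ 2 + q ^ 2) := by positivity
    rw [hk] at this
    exact pos_of_mul_pos_right this (by linarith)
  -- The reducedness bound `2 q ≤ t p`, freed of `t` by the equation.
  have h3 : 2 * q * (d * p * q - 8) ≤ d * (p ^ 2 + q ^ 2) * p := by
    rw [hk]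
    nlinarith [mul_le_mul_of_nonneg_right hq hk0.le]
  have hq17 : q ≤ 17 := by
    by_contra! hc
    have h4 : d * p * (q ^ 2 - p ^ 2) ≤ 16 * q := by nlinarith
    have h5 : q ^ 2 - p ^ 2 ≤ 16 * q := by
      have : 0 ≤ q ^ 2 - p ^ 2 := by nlinarith
      nlinarith [mul_pos hd hp]
    nlinarith
  clear h h0 h1 h3 hk0
  unfold ReducedPair
  interval_cases p
  · interval_cases d <;> clear h2 <;> interval_cases q <;> omega
  · have : d ≤ 6 := by omega
    interval_cases d <;> interval_cases q <;> omega
  · have : d ≤ 2 := by omega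
    interval_cases d <;> interval_cases q <;> omega
  · have : d ≤ 1 := by omega
    interval_cases d; interval_cases q <;> omega

/-- Vieta jumping: for fixed `p` the roots in `q` have sum `t p`. If `2 q > t p`, the other root `t
p - q` is smaller than `q`, and it is positive because `d q (t p - q) = d p² + 8 t`. The induction
is on a bound for `p + q`. -/
theorem reducedPair_of_solution {t d : ℤ} (ht : 3 ≤ t) (hd : 0 < d) :
    ∀ (n : ℕ) (p q : ℤ), 0 < p → 0 < q → p + q ≤ n →
      d * (t * p * q - p ^ 2 - q ^ 2) = 8 * t → ReducedPair t d := by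
  intro n
  induction n with
  | zero => intro p q hp hq hn; push_cast at hn; omega
  | succ n ih =>
    have key : ∀ p q : ℤ, 0 < p → p ≤ q → p + q ≤ (n + 1 : ℕ) →
        d * (t * p * q - p ^ 2 - q ^ 2) = 8 * t → ReducedPair t d := by
      intro p q hp hpq hn h
      by_cases hq : 2 * q ≤ t * p
      · exact reducedPair_of_reduced ht hd hp hpq hq h
      · have hq0 : 0 < q := by linarith
        have hpos : 0 < (d * q) * (t * p - q) := by
          have : (d * q) * (t * p - q) = d * p ^ 2 + 8 * t := by linear_combination h
          rw [this]; positivity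
        refine ih p (t * p - q) hp (pos_of_mul_pos_right hpos (by positivity)) ?_ ?_
        · push_cast at hn; omega
        · linear_combination h
    intro p q hp hq hn h
    rcases le_total p q with hpq | hpq
    · exact key p q hp hpq hn h
    · exact key q p hq hpq (by linarith) (by linear_combination h)

/-! ### From Pythagorean triples to the five families -/

/-- After division by the gcd the cofactors are coprime with square product, hence squares up to
sign; the sign hypotheses settle the rest. -/
theorem exists_sq_of_mul_eq_sq {A B s : ℤ} (hA : 0 ≤ A) (hB : 0 < B) (h : A * B = s ^ 2) :
    ∃ g X Y : ℤ, 0 < g ∧ 0 ≤ X ∧ 0 < Y ∧ A = g * X ^ 2 ∧ B = g * Y ^ 2 := by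
  have hg : 0 < (Int.gcd A B : ℤ) := by
    exact_mod_cast Int.gcd_pos_of_ne_zero_right A hB.ne'
  obtain ⟨A', hA'⟩ := Int.gcd_dvd_left A B
  obtain ⟨B', hB'⟩ := Int.gcd_dvd_right A B
  have hco : Int.gcd A' B' = 1 := by
    have h1 := Int.gcd_mul_left (Int.gcd A B : ℤ) A' B'
    rw [← hA', ← hB', Int.natAbs_natCast] at h1
    have hg' : 0 < Int.gcd A B := by exact_mod_cast hg
    exact Nat.eq_of_mul_eq_mul_left hg' (by omega)
  set g : ℤ := (Int.gcd A B : ℤ)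
  have hA0 : 0 ≤ A' := by
    by_contra! hc
    nlinarith
  have hB0 : 0 < B' := by
    by_contra! hc
    nlinarith
  obtain ⟨r, hr⟩ : g ∣ s := by
    rw [← Int.pow_dvd_pow_iff two_ne_zero, ← h]
    exact ⟨A' * B', by rw [hA', hB']; ring⟩
  have hr2 : A' * B' = r ^ 2 := by
    have : g ^ 2 * (A' * B') = g ^ 2 * r ^ 2 := by
      rw [← mul_pow, ← hr, ← h]
      conv_rhs => rw [hA', hB']
      ring
    exact mul_left_cancel₀ (by positivity) this
  have sq_of : ∀ z w : ℤ, 0 ≤ z → (z = w ^ 2 ∨ z = -w ^ 2) → z = |w| ^ 2 := by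
    intro z w hz hzw
    rw [sq_abs]
    rcases hzw with h | h <;> nlinarith [sq_nonneg w]
  obtain ⟨x, hx⟩ := Int.sq_of_gcd_eq_one hco hr2
  obtain ⟨y, hy⟩ := Int.sq_of_gcd_eq_one (Int.gcd_comm A' B' ▸ hco) (by rw [mul_comm]; exact hr2)
  have hx' := sq_of _ _ hA0 hx
  have hy' := sq_of _ _ hB0.le hy
  refine ⟨g, |x|, |y|, hg, abs_nonneg x, ?_, by rw [← hx', ← hA'], by rw [← hy', ← hB']⟩
  rcases (abs_nonneg y).lt_or_eq with h | h
  · exact h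
  · rw [← h] at hy'; simp at hy'; omega

/-- The integral form of the five families. -/
def InFamilies (t c : ℤ) : Prop :=
  (∃ x y : ℤ, y ^ 2 - 5 * x ^ 2 = 4 ∧ t = 3 ∧ 2 * c = 3 * (x ^ 2 + y ^ 2)) ∨
  (∃ x y : ℤ, y ^ 2 - 3 * x ^ 2 = 1 ∧ t = 4 ∧ c = 4 * (x ^ 2 + y ^ 2)) ∨
  (∃ x y : ℤ, 3 * y ^ 2 - 7 * x ^ 2 = 20 ∧ t = 5 ∧ 2 * c = x ^ 2 + y ^ 2) ∨
  (∃ x y : ℤ, y ^ 2 - 2 * x ^ 2 = 1 ∧ t = 6 ∧ c = 3 * (x ^ 2 + y ^ 2)) ∨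
  (∃ x y : ℤ, 2 * y ^ 2 - 3 * x ^ 2 = 5 ∧ t = 10 ∧ c = x ^ 2 + y ^ 2)

theorem sq_eq_of_parity (x : ℤ) : (∃ k, x = 2 * k) ∨ ∃ j, x ^ 2 = 8 * j + 1 := by
  rcases Int.even_or_odd x with ⟨k, hk⟩ | hx
  · exact .inl ⟨k, by omega⟩
  · obtain ⟨j, hj⟩ := Int.eight_dvd_sq_sub_one_of_odd hx
    exact .inr ⟨j, by omega⟩

theorem even_of (x y : ℤ)
    (h : ∀ i j : ℤ, (x ^ 2 = 8 * i + 1 → y ^ 2 ≠ 8 * j + 1) ∧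
      (x ^ 2 = 8 * i + 1 → y ^ 2 ≠ 4 * j) ∧ (x ^ 2 = 4 * i → y ^ 2 ≠ 8 * j + 1)) :
    (∃ k, x = 2 * k) ∧ ∃ k, y = 2 * k := by
  rcases sq_eq_of_parity x with ⟨k, rfl⟩ | ⟨i, hi⟩ <;>
  rcases sq_eq_of_parity y with ⟨l, rfl⟩ | ⟨j, hj⟩
  · exact ⟨⟨k, rfl⟩, l, rfl⟩
  · exact absurd hj ((h (k ^ 2) j).2.2 (by ring))
  · exact absurd (by ring) ((h i (l ^ 2)).2.1 hi)
  · exact absurd hj ((h i j).1 hi)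

/-- The surviving pairs differ from the family equations by scaling `X, Y` by powers of 2; where
halving is needed, integrality of `h` and `c` supplies the parity. The other pairs have no solution
modulo a power of 2. -/
theorem inFamilies_of_reducedPair {t c h g X Y : ℤ} (hr : ReducedPair t g)
    (hN : g * ((t - 2) * Y ^ 2 - (t + 2) * X ^ 2) = 8 * t) (hh : g * (Y ^ 2 - X ^ 2) = 4 * h)
    (hc : g * (X ^ 2 + Y ^ 2) = 4 * c) : InFamilies t c := by
  unfold InFamilies
  rcases hr with ⟨rfl, rfl | rfl⟩ | ⟨rfl, rfl | rfl | rfl⟩ | ⟨rfl, rfl | rfl⟩ |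
    ⟨rfl, rfl | rfl | rfl⟩ | ⟨rfl, rfl | rfl | rfl⟩ | ⟨rfl, rfl | rfl⟩ | ⟨rfl, rfl⟩ | ⟨rfl, rfl⟩ |
    ⟨rfl, rfl⟩ | ⟨rfl, rfl⟩
  · exact .inl ⟨X, Y, by linarith, rfl, by linarith⟩
  · exact .inl ⟨2 * X, 2 * Y, by linarith, rfl, by linarith⟩
  · obtain ⟨⟨x, rfl⟩, y, rfl⟩ := even_of X Y (by omega)
    obtain ⟨⟨x, rfl⟩, y, rfl⟩ := even_of x y (by ring_nf at hN; omega)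
    exact .inr (.inl ⟨x, y, by linarith, rfl, by linarith⟩)
  · obtain ⟨⟨x, rfl⟩, y, rfl⟩ := even_of X Y (by omega)
    exact .inr (.inl ⟨x, y, by linarith, rfl, by linarith⟩)
  · exact .inr (.inl ⟨X, Y, by linarith, rfl, by linarith⟩)
  · exact .inr (.inr (.inl ⟨X, Y, by linarith, rfl, by linarith⟩))
  · exact .inr (.inr (.inl ⟨2 * X, 2 * Y, by linarith, rfl, by linarith⟩))
  · obtain ⟨⟨x, rfl⟩, y, rfl⟩ := even_of X Y (by omega)
    exact .inr (.inr (.inr (.inl ⟨x, y, by linarith, rfl, by linarith⟩)))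
  -- Defers the pair `(6, 6)`, which is impossible, to the final block.
  rotate_left
  · exact .inr (.inr (.inr (.inl ⟨X, Y, by linarith, rfl, by linarith⟩)))
  · obtain ⟨⟨x, rfl⟩, y, rfl⟩ := even_of X Y (by omega)
    exact .inr (.inr (.inr (.inr ⟨x, y, by linarith, rfl, by linarith⟩)))
  · exact .inr (.inr (.inr (.inr ⟨X, Y, by linarith, rfl, by linarith⟩)))
  all_goals
    exfalso
    obtain ⟨⟨x, rfl⟩, y, rfl⟩ := even_of X Y (by omega)
    rcases sq_eq_of_parity x with ⟨x, rfl⟩ | ⟨i, hi⟩ <;>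
    rcases sq_eq_of_parity y with ⟨y, rfl⟩ | ⟨j, hj⟩ <;> ring_nf at * <;> omega

/-- If `s, h, c` is a Pythagorean triple and `t (h - 2) = 2 c`, then `(t, c)` lies in one of the
five families. -/
theorem inFamilies_of_triple {t s h c : ℤ} (ht : 0 < t) (hh : 0 < h) (hc : 0 < c)
    (hs : s ^ 2 + h ^ 2 = c ^ 2) (he : t * (h - 2) = 2 * c) : InFamilies t c := by
  have hch : h ≤ c := by nlinarith [sq_nonneg s]
  have hh3 : 3 ≤ h := by
    have : 0 < h - 2 := pos_of_mul_pos_right (by rw [he]; positivity) ht.le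
    omega
  have ht3 : 3 ≤ t := by
    by_contra! hlt
    nlinarith
  have hB : 0 < (t + 2) * h - 2 * t := by nlinarith
  have hAB : ((t - 2) * h - 2 * t) * ((t + 2) * h - 2 * t) = (2 * s) ^ 2 := by
    linear_combination (t * (h - 2) + 2 * c) * he - 4 * hs
  have hA : 0 ≤ (t - 2) * h - 2 * t := by
    by_contra! hlt
    nlinarith [sq_nonneg (2 * s)]
  obtain ⟨g, X, Y, hg, hX, hY, hgX, hgY⟩ := exists_sq_of_mul_eq_sq hA hB hAB
  have hN : g * ((t - 2) * Y ^ 2 - (t + 2) * X ^ 2) = 8 * t := by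
    linear_combination (t + 2) * hgX - (t - 2) * hgY
  have hgh : g * (Y ^ 2 - X ^ 2) = 4 * h := by linear_combination hgX - hgY
  have hgc : g * (X ^ 2 + Y ^ 2) = 4 * c := by linear_combination 2 * he - hgX - hgY
  have hXY : X < Y := by
    by_contra! hle
    have : Y ^ 2 ≤ X ^ 2 := by nlinarith
    nlinarith
  refine inFamilies_of_reducedPair (h := h) ?_ hN hgh hgc
  exact reducedPair_of_solution ht3 hg (Y - X + (Y + X)).toNat (Y - X) (Y + X) (by omega)
    (by omega) (by omega) (by linear_combination hN)

/-- The pairs of positive integers `t, c` coming from a Pythagorean triple `s, h, c` with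
`t (h - 2) = 2 c`. -/
def IsTriplePair (t c : ℤ) : Prop :=
  0 < t ∧ 0 < c ∧ ∃ s h : ℤ, 0 < h ∧ s ^ 2 + h ^ 2 = c ^ 2 ∧ t * (h - 2) = 2 * c

theorem IsTriplePair.inFamilies {t c : ℤ} (h : IsTriplePair t c) : InFamilies t c := by
  obtain ⟨ht, hc, s, h, hh, hs, he⟩ := h
  exact inFamilies_of_triple ht hh hc hs he

theorem IsTriplePair.inFamilies_swap {t c : ℤ} (h : IsTriplePair t c) (hle : c ≤ t) :
    InFamilies c t := by
  obtain ⟨ht, hc, s, h, hh, hs, he⟩ := h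
  have h2 : 0 < h - 2 := pos_of_mul_pos_right (by rw [he]; positivity) ht.le
  -- From `t (h - 2) = 2 c ≤ 2 t`. The factorization `(c - r) (c + r) = h² ≤ 16` then bounds `c`.
  have h4 : h ≤ 4 := by
    by_contra! hlt
    nlinarith
  have hcs : c ^ 2 - |s| ^ 2 = h ^ 2 := by rw [sq_abs]; linarith
  have hs0 := abs_nonneg s
  generalize |s| = r at hcs hs0
  have hrc : r < c := by
    by_contra! hlt
    nlinarith
  have hc8 : c ≤ 8 := by
    by_contra! hlt
    nlinarith
  have hh' : h = 3 ∨ h = 4 := by omega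
  clear hs
  unfold InFamilies
  rcases hh' with rfl | rfl <;> interval_cases c <;> interval_cases r <;> try omega
  · exact .inl ⟨0, 2, by norm_num, rfl, by linarith⟩
  · exact .inr (.inr (.inl ⟨2, 4, by norm_num, rfl, by linarith⟩))
  · exact .inr (.inl ⟨0, 1, by norm_num, rfl, by linarith⟩)
  · exact .inr (.inr (.inl ⟨1, 3, by norm_num, rfl, by linarith⟩))

theorem isTriplePair_of_inFamilies {t c : ℤ} (h : InFamilies t c) : IsTriplePair t c := by
  have cpos : ∀ x y : ℤ, y ≠ 0 → 0 < x ^ 2 + y ^ 2 := fun x y hy => by positivity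
  rcases h with ⟨x, y, h, rfl, hc⟩ | ⟨x, y, h, rfl, hc⟩ | ⟨x, y, h, rfl, hc⟩ |
    ⟨x, y, h, rfl, hc⟩ | ⟨x, y, h, rfl, hc⟩
  all_goals
    have hy : y ≠ 0 := by rintro rfl; nlinarith [sq_nonneg x]
    have hxy := cpos x y hy
    refine ⟨by norm_num, by linarith, ?_⟩
  -- In all five cases `s = g x y / 2` and `h = g (y² - x²) / 4`, with `g = 6, 16, 2, 12, 4`; here
  -- and in the third case `h` is written through `c` to avoid a division.
  · refine ⟨3 * x * y, c - 3 * x ^ 2, by nlinarith, ?_, ?_⟩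
    · linear_combination -3 * x ^ 2 * hc
    · linarith
  · refine ⟨8 * x * y, 4 * (y ^ 2 - x ^ 2), by nlinarith, by rw [hc]; ring, by linarith⟩
  · refine ⟨x * y, c - x ^ 2, by nlinarith, ?_, by linarith⟩
    linear_combination -x ^ 2 * hc
  · refine ⟨6 * x * y, 3 * (y ^ 2 - x ^ 2), by nlinarith, by rw [hc]; ring, by linarith⟩
  · refine ⟨2 * x * y, y ^ 2 - x ^ 2, by nlinarith, by rw [hc]; ring, by linarith⟩

/-! ### Plane geometry of the parallelogram and its rectangle -/

open MeasureTheory Set Pointwise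

/-- The determinant of a pair of plane vectors. -/
def planeDet (u v : Plane) : ℝ := u 0 * v 1 - u 1 * v 0

theorem planeDet_sq (u v : Plane) :
    planeDet u v ^ 2 = ‖u‖ ^ 2 * ‖v‖ ^ 2 - inner ℝ u v ^ 2 := by
  simp [EuclideanSpace.real_norm_sq_eq, PiLp.inner_apply, Fin.sum_univ_two, planeDet]
  ring

theorem area_eq_planeDet {P : Fin 4 → Plane} (h : P 1 - P 0 = P 2 - P 3) :
    area P = |planeDet (P 1 - P 0) (P 3 - P 0)| := by
  set u := P 1 - P 0 with hu
  set v := P 3 - P 0 with hv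
  have hrange : range P = {P 0} + ({0, u, v, u + v} : Set Plane) := by
    ext z
    have h1 : P 1 = P 0 + u := by rw [hu]; abel
    have h3 : P 3 = P 0 + v := by rw [hv]; abel
    have h2 : P 2 = P 0 + (u + v) := by rw [h, hv]; abel
    simp [Fin.exists_fin_succ, h1, h2, h3, or_comm, neg_add_eq_zero]
    grind
  have hpar : convexHull ℝ ({0, u, v, u + v} : Set Plane) = parallelepiped ![u, v] := by
    rw [parallelepiped_eq_convexHull]
    congr 1
    ext z
    simp [Fin.sum_univ_two, Set.mem_add]
    grind
  rw [area, hrange, convexHull_add, convexHull_singleton, hpar, singleton_add, image_add_left,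
    Measure.real, measure_preimage_add]
  have := (EuclideanSpace.basisFun (Fin 2) ℝ).addHaar_eq_volume
  rw [← this, Measure.addHaar_parallelepiped, ENNReal.toReal_ofReal (abs_nonneg _)]
  congr 1
  simp [Module.Basis.det_apply, Matrix.det_fin_two, Module.Basis.toMatrix_apply, planeDet]
  ring

theorem perimeter_eq {P : Fin 4 → Plane} (h : P 1 - P 0 = P 2 - P 3) :
    perimeter P = 2 * (dist (P 0) (P 1) + dist (P 1) (P 2)) := by
  have h1 : dist (P 2) (P 3) = dist (P 0) (P 1) := by
    rw [dist_eq_norm, ← h, ← dist_eq_norm, dist_comm]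
  have h2 : dist (P 3) (P 0) = dist (P 1) (P 2) := by
    rw [dist_comm (P 1), dist_eq_norm, dist_eq_norm]
    congr 1
    rw [sub_eq_sub_iff_add_eq_add] at h ⊢
    rw [add_comm, h]
  rw [perimeter, Fin.sum_univ_four]
  change dist (P 0) (P 1) + dist (P 1) (P 2) + dist (P 2) (P 3) + dist (P 3) (P 0) = _
  rw [h1, h2]
  ring

theorem planeDet_ne_zero {u v : Plane} (h : LinearIndependent ℝ ![u, v]) : planeDet u v ≠ 0 := by
  intro h0
  have hu : u ≠ 0 := h.ne_zero 0
  rw [LinearIndependent.pair_iff] at h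
  unfold planeDet at h0
  have h1 := h (v 0) (-u 0) (by
    ext i; fin_cases i <;> simp <;> linarith)
  have h2 := h (v 1) (-u 1) (by
    ext i; fin_cases i <;> simp <;> linarith)
  apply hu
  ext i; fin_cases i
  · simpa using h1.2
  · simpa using h2.2

/-- Two nonnegative reals with integral squares and integral doubled sum are integers. -/
theorem exists_int_of_sq {a b : ℝ} {m n k : ℤ} (ha : 0 ≤ a) (hb : 0 ≤ b) (hm : a ^ 2 = m)
    (hn : b ^ 2 = n) (hk : 2 * (a + b) = k) : ∃ z : ℤ, a = z := by
  by_cases hk0 : k = 0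
  · exact ⟨0, by rw [hk0] at hk; push_cast at hk ⊢; linarith⟩
  -- `a` is rational because `a² - b²` and `a + b` are; an integer square then makes it an integer.
  have h1 : 4 * k * a = (k ^ 2 + 4 * m - 4 * n : ℤ) := by
    push_cast
    rw [← hk, ← hm, ← hn]
    ring
  have h2 : (4 * k) ^ 2 * m = (k ^ 2 + 4 * m - 4 * n) ^ 2 := by
    have : ((4 * k : ℝ)) ^ 2 * m = ((k ^ 2 + 4 * m - 4 * n : ℤ) : ℝ) ^ 2 := by
      rw [← h1, ← hm]; ring
    exact_mod_cast this
  obtain ⟨z, hz⟩ := (Int.pow_dvd_pow_iff two_ne_zero).1 (Dvd.intro _ h2)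
  refine ⟨z, ?_⟩
  have h3 : (4 * k : ℝ) ≠ 0 := by exact_mod_cast mul_ne_zero four_ne_zero hk0
  apply mul_left_cancel₀ h3
  rw [h1, hz]
  push_cast
  ring

/-- The core computation: one vertex of the parallelogram lies on the side `e` of the rectangle
spanned by `e` and `f`. -/
theorem isTriplePair_of_collinear {u v e f : Plane} {α : ℝ} {a b m n : ℤ} (hα : 0 ≤ α)
    (hu : u = α • e) (hv : v = (1 - α) • e + f) (hef : inner ℝ e f = 0) (he : ‖e‖ = m)
    (hf : ‖f‖ = n) (ha : ‖u‖ = a) (hb : ‖v‖ = b) (hdet : planeDet u v ≠ 0)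
    (harea : 2 * ((a : ℝ) + b) = |planeDet u v|) : IsTriplePair a b := by
  have hu0 : u ≠ 0 := by rintro rfl; simp [planeDet] at hdet
  have hv0 : v ≠ 0 := by rintro rfl; simp [planeDet] at hdet
  have hα' : α * m = a := by rw [← ha, hu, norm_smul, Real.norm_of_nonneg hα, he]
  have hinner : inner ℝ u v = a * (m - a) := by
    rw [hu, hv, inner_smul_left, inner_add_right, inner_smul_right, hef, real_inner_self_eq_norm_sq,
      he, ← hα']
    simp
    ring
  have hbsq : ((m - a : ℝ)) ^ 2 + n ^ 2 = b ^ 2 := by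
    rw [← hb, hv, norm_add_sq_real, inner_smul_left, hef, norm_smul, he, hf, mul_pow,
      Real.norm_eq_abs, sq_abs, ← hα']
    simp
    ring
  have hn : (0 : ℝ) ≤ n := hf ▸ norm_nonneg f
  have hapos : (0 : ℝ) < a := ha ▸ norm_pos_iff.2 hu0
  have hbpos : (0 : ℝ) < b := hb ▸ norm_pos_iff.2 hv0
  -- Base times height, through the Lagrange identity `planeDet_sq`.
  have hd : |planeDet u v| = a * n := by
    rw [← abs_of_nonneg (mul_nonneg hapos.le hn), ← sq_eq_sq_iff_abs_eq_abs, planeDet_sq, hinner,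
      ha, hb, ← hbsq]
    ring
  rw [hd] at harea
  have harea' : 2 * (a + b) = a * n := by exact_mod_cast harea
  have hn0 : 0 < n := by
    have h0 : 0 < a := by exact_mod_cast hapos
    have h1 : 0 < b := by exact_mod_cast hbpos
    exact pos_of_mul_pos_right (by rw [← harea']; positivity) h0.le
  exact ⟨by exact_mod_cast hapos, by exact_mod_cast hbpos, m - a, n, hn0, by exact_mod_cast hbsq,
    by linarith⟩

theorem isTriplePair_of_mem_side {p₀ p₁ u v e f : Plane} {a b m n : ℤ} {R : Fin 4 → Plane}
    (j k : Fin 4) (hp₀ : p₀ = R j) (hp₁ : p₁ = p₀ + u) (he' : R (j + 1) = R j + e)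
    (hf' : R (j + 3) = R j + f) (hef' : R (j + 2) = R j + (e + f)) (huv : u + v = e + f)
    (hk : p₁ ∈ segment ℝ (R k) (R (k + 1)))
    (hef : inner ℝ e f = 0) (he : ‖e‖ = m) (hf : ‖f‖ = n) (ha : ‖u‖ = a) (hb : ‖v‖ = b)
    (hdet : planeDet u v ≠ 0) (harea : 2 * ((a : ℝ) + b) = |planeDet u v|) :
    IsTriplePair a b ∨ IsTriplePair b a := by
  obtain ⟨l, rfl⟩ : ∃ l, k = j + l := ⟨k - j, by abel⟩
  obtain ⟨x, y, hx, hy, hxy, hz⟩ := hk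
  have hv : v = e + f - u := by rw [← huv]; abel
  have hswap : planeDet v u = -planeDet u v := by unfold planeDet; ring
  have hdet' : planeDet v u ≠ 0 := by rw [hswap]; exact neg_ne_zero.2 hdet
  have harea' : 2 * ((b : ℝ) + a) = |planeDet v u| := by rw [hswap, abs_neg, ← harea]; ring
  have hfe : inner ℝ f e = 0 := by rw [real_inner_comm]; exact hef
  obtain rfl : x = 1 - y := by linarith
  rw [hp₁, hp₀] at hz
  have key : ∀ w : Plane, R j + w = R j + u → u = w := fun w hw => (add_left_cancel hw).symm
  -- On the two sides through `R j` the edge `u` lies along the rectangle; on the two opposite sides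
  -- `v` does, and the roles of `a` and `b` are exchanged.
  fin_cases l
  · have hu := key (y • e) (by rw [← hz]; simp [he']; module)
    exact .inl (isTriplePair_of_collinear hy hu (by rw [hv, hu]; module) hef he hf ha hb hdet harea)
  · have h2 : j + 1 + 1 = j + 2 := by rw [add_assoc]; rfl
    have hu := key (e + y • f) (by rw [← hz]; simp [he', h2, hef']; module)
    exact .inr (isTriplePair_of_collinear (α := 1 - y) (by linarith) (by rw [hv, hu]; module)
      (by rw [hu]; module) hfe hf he hb ha hdet' harea')
  · have h2 : j + 2 + 1 = j + 3 := by rw [add_assoc]; rfl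
    have hu := key ((1 - y) • e + f) (by rw [← hz]; simp [hf', h2, hef']; module)
    exact .inr (isTriplePair_of_collinear (α := y) hy (by rw [hv, hu]; module)
      hu hef he hf hb ha hdet' harea')
  · have h2 : j + 3 + 1 = j := by rw [add_assoc]; exact add_zero j
    have hu := key ((1 - y) • f) (by rw [← hz]; simp [hf', h2]; module)
    exact .inl (isTriplePair_of_collinear hx hu (by rw [hv, hu]; module) hfe hf he ha hb hdet harea)

/-- The edge vectors of a parallelogram at each of its vertices. -/
theorem IsParallelogram.edges {P : Fin 4 → Plane} (h : IsParallelogram P) (i : Fin 4) :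
    ∃ u v : Plane, P (i + 1) = P i + u ∧ P (i + 3) = P i + v ∧ P (i + 2) = P i + (u + v) ∧
      |planeDet u v| = |planeDet (P 1 - P 0) (P 3 - P 0)| ∧
      (inner ℝ (P 1 - P 0) (P 3 - P 0) = (0 : ℝ) → inner ℝ u v = (0 : ℝ)) ∧
      ‖u‖ = dist (P i) (P (i + 1)) ∧ ‖v‖ = dist (P (i + 1)) (P (i + 2)) := by
  have h3 : P 3 = P 0 + P 2 - P 1 := by
    have := h.1
    rw [sub_eq_sub_iff_add_eq_add] at this
    rw [eq_sub_iff_add_eq, add_comm, this, add_comm]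
  refine ⟨P (i + 1) - P i, P (i + 3) - P i, by abel, by abel, ?_, ?_, ?_, ?_, ?_⟩
  · fin_cases i <;> simp [h3] <;> abel
  · fin_cases i <;> simp [h3, planeDet] <;> (congr 1; ring)
  · fin_cases i <;> simp [h3, PiLp.inner_apply, Fin.sum_univ_two]  <;> intro h <;> linarith
  · rw [dist_comm, dist_eq_norm]
  · rw [dist_comm, dist_eq_norm]
    congr 1
    fin_cases i <;> simp [h3] <;> abel

theorem IsParallelogram.adjacent_sides {P : Fin 4 → Plane} (h : IsParallelogram P) (i : Fin 4) :
    (dist (P i) (P (i + 1)) = dist (P 0) (P 1) ∧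
        dist (P (i + 1)) (P (i + 2)) = dist (P 1) (P 2)) ∨
      (dist (P i) (P (i + 1)) = dist (P 1) (P 2) ∧
        dist (P (i + 1)) (P (i + 2)) = dist (P 0) (P 1)) := by
  obtain ⟨u, v, h1, h3, h2, -⟩ := h.edges 0
  simp only [Fin.isValue, zero_add] at h1 h2 h3
  fin_cases i <;> simp [h1, h2, h3, dist_eq_norm]

/-- The side lengths of a lattice equable parallelogram are integers. -/
theorem IsLEP.exists_int_sides {P : Fin 4 → Plane} (h : IsLEP P) :
    (∃ m : ℤ, dist (P 0) (P 1) = m) ∧ ∃ n : ℤ, dist (P 1) (P 2) = n := by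
  obtain ⟨hP, hint, heq⟩ := h
  rw [perimeter_eq hP.1, area_eq_planeDet hP.1] at heq
  choose z hz using hint
  have hsq : ∀ i j, dist (P i) (P j) ^ 2 =
      (((z i 0 - z j 0) ^ 2 + (z i 1 - z j 1) ^ 2 : ℤ) : ℝ) := by
    intro i j
    rw [dist_eq_norm, EuclideanSpace.real_norm_sq_eq]
    simp [Fin.sum_univ_two, hz]
  have hk : 2 * (dist (P 0) (P 1) + dist (P 1) (P 2)) =
      ((|(z 1 0 - z 0 0) * (z 3 1 - z 0 1) - (z 1 1 - z 0 1) * (z 3 0 - z 0 0)| : ℤ) : ℝ) := by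
    rw [heq]
    simp [planeDet, hz]
  exact ⟨exists_int_of_sq dist_nonneg dist_nonneg (hsq 0 1) (hsq 1 2) hk,
    exists_int_of_sq dist_nonneg dist_nonneg (hsq 1 2) (hsq 0 1) (by rw [add_comm]; exact hk)⟩

theorem IsPythagoreanLEP.isTriplePair {P : Fin 4 → Plane} (h : IsPythagoreanLEP P) :
    ∃ a b : ℤ, dist (P 0) (P 1) = a ∧ dist (P 1) (P 2) = b ∧
      (IsTriplePair a b ∨ IsTriplePair b a) := by
  obtain ⟨hL, R, ⟨hR, hRo⟩, hRint, hcirc, i, j, hij, hij2⟩ := h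
  obtain ⟨⟨a, ha⟩, b, hb⟩ := hL.exists_int_sides
  refine ⟨a, b, ha, hb, ?_⟩
  obtain ⟨hP, -, heq⟩ := hL
  rw [perimeter_eq hP.1, area_eq_planeDet hP.1, ha, hb] at heq
  obtain ⟨u, v, hu, -, huv, hdet, -, hnu, hnv⟩ := hP.edges i
  obtain ⟨e, f, he, hf, hef, -, ho, hne, hnf⟩ := hR.edges j
  obtain ⟨m, hm⟩ := hRint j
  obtain ⟨n, hn⟩ := hRint (j + 1)
  rw [add_assoc] at hn
  obtain ⟨k, hk⟩ := hcirc (i + 1)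
  have hsum : u + v = e + f := by
    rw [huv, hef, hij] at hij2
    exact add_left_cancel hij2
  have hdet0 : planeDet u v ≠ 0 := by
    rw [← abs_ne_zero, hdet, abs_ne_zero]
    exact planeDet_ne_zero hP.2
  rcases hP.adjacent_sides i with ⟨h1, h2⟩ | ⟨h1, h2⟩
  · exact isTriplePair_of_mem_side j k hij hu he hf hef hsum hk (ho hRo) (hne.trans hm)
      (hnf.trans hn) (hnu.trans (h1.trans ha)) (hnv.trans (h2.trans hb)) hdet0 (by rw [heq, hdet])
  · exact (isTriplePair_of_mem_side j k hij hu he hf hef hsum hk (ho hRo) (hne.trans hm)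
      (hnf.trans hn) (hnu.trans (h1.trans hb)) (hnv.trans (h2.trans ha)) hdet0
      (by rw [hdet, ← heq]; ring)).symm

/-! ### Construction from a triple -/

theorem isParallelogram_of_coords {t s h : ℝ} (ht : t ≠ 0) (hh : h ≠ 0) :
    IsParallelogram ![!₂[0, 0], !₂[t, 0], !₂[t + s, h], !₂[s, h]] := by
  constructor
  · ext i
    fin_cases i <;> simp
  · rw [LinearIndependent.pair_iff]
    intro x y hxy
    have h0 := congrArg (fun w : Plane => w 0) hxy
    have h1 := congrArg (fun w : Plane => w 1) hxy
    simp [hh] at h0 h1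
    subst h1
    simpa [ht] using h0

theorem dist_coords {a b c d r : ℝ} (hr : 0 ≤ r) (h : (a - c) ^ 2 + (b - d) ^ 2 = r ^ 2) :
    dist (!₂[a, b] : Plane) !₂[c, d] = r := by
  simp [EuclideanSpace.dist_eq, Fin.sum_univ_two, Real.dist_eq, h, Real.sqrt_sq hr]

theorem IsTriplePair.mem_pythagoreanSides {t c : ℤ} (h : IsTriplePair t c) :
    ((t : ℝ), (c : ℝ)) ∈ pythagoreanSides := by
  obtain ⟨ht, hc, s', h, hh, hs', he⟩ := h
  -- A nonnegative offset keeps the parallelogram inside the `(t + s) × h` rectangle.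
  obtain ⟨s, hs0, hs⟩ : ∃ s : ℤ, 0 ≤ s ∧ s ^ 2 + h ^ 2 = c ^ 2 :=
    ⟨|s'|, abs_nonneg _, by rw [sq_abs]; exact hs'⟩
  have htR : (0 : ℝ) < t := by exact_mod_cast ht
  have hcR : (0 : ℝ) < c := by exact_mod_cast hc
  have hhR : (0 : ℝ) < h := by exact_mod_cast hh
  have hsR : (0 : ℝ) ≤ s := by exact_mod_cast hs0
  have hsqR : (s : ℝ) ^ 2 + h ^ 2 = c ^ 2 := by exact_mod_cast hs
  have heR : (t : ℝ) * (h - 2) = 2 * c := by exact_mod_cast he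
  have hP := isParallelogram_of_coords (s := (s : ℝ)) htR.ne' hhR.ne'
  have hR := isParallelogram_of_coords (s := 0) (add_pos_of_pos_of_nonneg htR hsR).ne' hhR.ne'
  set P : Fin 4 → Plane := ![!₂[0, 0], !₂[(t : ℝ), 0], !₂[(t : ℝ) + s, h], !₂[(s : ℝ), h]] with hPd
  set R : Fin 4 → Plane := ![!₂[0, 0], !₂[(t + s : ℝ), 0], !₂[(t + s : ℝ) + 0, h], !₂[0, (h : ℝ)]]
    with hRd
  have h01 : dist (P 0) (P 1) = t := by
    exact dist_coords htR.le (by ring)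
  have h12 : dist (P 1) (P 2) = c := by
    exact dist_coords hcR.le (by rw [← hsqR]; ring)
  refine ⟨P, ⟨⟨hP, ?_, ?_⟩, R, ⟨hR, ?_⟩, ?_, ?_, 0, 0, rfl, by simp [hPd, hRd]⟩, .inl ⟨h01, h12⟩⟩
  · intro i j
    fin_cases i <;> fin_cases j
    exacts [⟨0, by simp [hPd]⟩, ⟨0, by simp [hPd]⟩, ⟨t, by simp [hPd]⟩, ⟨0, by simp [hPd]⟩,
      ⟨t + s, by simp [hPd]⟩, ⟨h, by simp [hPd]⟩, ⟨s, by simp [hPd]⟩, ⟨h, by simp [hPd]⟩]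
  · rw [perimeter_eq hP.1, area_eq_planeDet hP.1, h01, h12]
    simp [hPd, planeDet, abs_of_pos htR, abs_of_pos hhR]
    linarith
  · simp [hRd, PiLp.inner_apply, Fin.sum_univ_two]
  · have hts : (0 : ℝ) ≤ t + s := by positivity
    intro j
    fin_cases j
    · exact ⟨t + s, by push_cast; exact dist_coords hts (by ring)⟩
    · exact ⟨h, dist_coords hhR.le (by ring)⟩
    · exact ⟨t + s, by push_cast; exact dist_coords hts (by ring)⟩
    · exact ⟨h, dist_coords hhR.le (by ring)⟩
  · have hts : (t + s : ℝ) ≠ 0 := by positivity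
    intro i
    fin_cases i
    · exact ⟨0, left_mem_segment _ _ _⟩
    · refine ⟨0, s / (t + s), t / (t + s), by positivity, by positivity, by field_simp; ring, ?_⟩
      ext k; fin_cases k <;> simp [hPd, hRd]
      field_simp
    · refine ⟨2, ?_⟩
      have : P 2 = R 2 := by simp [hPd, hRd]
      exact this ▸ left_mem_segment _ _ _
    · refine ⟨2, s / (t + s), t / (t + s), by positivity, by positivity, by field_simp; ring, ?_⟩
      ext k; fin_cases k <;> simp [hPd, hRd]
      · field_simp
      · field_simp
        ring

/-! ### Passage between integer and real side pairs -/

theorem mem_families_iff {t c : ℤ} : InFamilies t c ↔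
    ((t : ℝ), (c : ℝ)) ∈ family1 ∨ ((t : ℝ), (c : ℝ)) ∈ family2 ∨ ((t : ℝ), (c : ℝ)) ∈ family3 ∨
      ((t : ℝ), (c : ℝ)) ∈ family4 ∨ ((t : ℝ), (c : ℝ)) ∈ family5 := by
  unfold InFamilies family1 family2 family3 family4 family5
  simp only [Set.mem_ofPred_eq, eq_div_iff (two_ne_zero' ℝ), mul_comm _ (2 : ℝ)]
  norm_cast

theorem IsPythagoreanLEP.inFamilies {P : Fin 4 → Plane} {a b : ℝ} (h : IsPythagoreanLEP P)
    (hs : HasSides P a b) (hab : a ≤ b) : ∃ t c : ℤ, a = t ∧ b = c ∧ InFamilies t c := by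
  obtain ⟨m, n, hm, hn, hT⟩ := h.isTriplePair
  obtain ⟨t, c, rfl, rfl, hT⟩ :
      ∃ t c : ℤ, a = t ∧ b = c ∧ (IsTriplePair t c ∨ IsTriplePair c t) := by
    rcases hs with ⟨ha, hb⟩ | ⟨hb, ha⟩
    · exact ⟨m, n, ha.symm.trans hm, hb.symm.trans hn, hT⟩
    · exact ⟨n, m, ha.symm.trans hn, hb.symm.trans hm, hT.symm⟩
  refine ⟨t, c, rfl, rfl, ?_⟩
  rcases hT with hT | hT
  · exact hT.inFamilies
  · exact hT.inFamilies_swap (by exact_mod_cast hab)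

theorem InFamilies.mem_pythagoreanSides {t c : ℤ} (h : InFamilies t c) :
    ((t : ℝ), (c : ℝ)) ∈ pythagoreanSides :=
  (isTriplePair_of_inFamilies h).mem_pythagoreanSides

theorem mem_pythagoreanSides_of_mem_families {p : ℝ × ℝ} (h : p ∈ family1 ∨ p ∈ family2 ∨ p ∈ family3 ∨
    p ∈ family4 ∨ p ∈ family5) : p ∈ pythagoreanSides := by
  obtain ⟨a, b⟩ := p
  obtain ⟨t, c, rfl, rfl⟩ : ∃ t c : ℤ, a = t ∧ b = c := by
    rcases h with ⟨x, y, h, h1, h2⟩ | ⟨x, y, h, h1, h2⟩ | ⟨x, y, h, h1, h2⟩ | ⟨x, y, h, h1, h2⟩ |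
      ⟨x, y, h, h1, h2⟩
    · obtain ⟨k, hk⟩ : (2 : ℤ) ∣ x ^ 2 + y ^ 2 := ⟨3 * x ^ 2 + 2, by linarith⟩
      have hk' : (x : ℝ) ^ 2 + (y : ℝ) ^ 2 = 2 * k := by exact_mod_cast hk
      exact ⟨3, 3 * k, by simpa using h1, by dsimp only at h2; rw [h2, hk']; push_cast; ring⟩
    · exact ⟨4, 4 * (x ^ 2 + y ^ 2), by simpa using h1, by simpa using h2⟩
    · obtain ⟨k, hk⟩ : (2 : ℤ) ∣ x ^ 2 + y ^ 2 := ⟨4 * x ^ 2 - y ^ 2 + 10, by linarith⟩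
      have hk' : (x : ℝ) ^ 2 + (y : ℝ) ^ 2 = 2 * k := by exact_mod_cast hk
      exact ⟨5, k, by simpa using h1, by dsimp only at h2; rw [h2, hk']; ring⟩
    · exact ⟨6, 3 * (x ^ 2 + y ^ 2), by simpa using h1, by simpa using h2⟩
    · exact ⟨10, x ^ 2 + y ^ 2, by simpa using h1, by simpa using h2⟩
  exact (mem_families_iff.2 h).mem_pythagoreanSides

/-! ### Infinitude of the families -/

/-- A solution set of a binary equation that is stable under an increasing substitution contains
solutions with arbitrarily large `x`. -/
theorem exists_large_solution {S : ℤ → ℤ → Prop} {f g : ℤ → ℤ → ℤ} {x₀ y₀ : ℤ} (hx₀ : 0 ≤ x₀)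
    (hy₀ : 0 < y₀) (h₀ : S x₀ y₀)
    (hS : ∀ x y, 0 ≤ x → 0 < y → S x y → S (f x y) (g x y) ∧ x < f x y ∧ 0 < g x y) (n : ℕ) :
    ∃ x y : ℤ, (n : ℤ) ≤ x ∧ 0 < y ∧ S x y := by
  induction n with
  | zero => exact ⟨x₀, y₀, by simpa using hx₀, hy₀, h₀⟩
  | succ n ih =>
    obtain ⟨x, y, hx, hy, h⟩ := ih
    obtain ⟨h1, h2, h3⟩ := hS x y (by omega) hy h
    exact ⟨f x y, g x y, by push_cast; omega, h3, h1⟩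

/-- A family parametrized by a solution set with arbitrarily large `x` is infinite. -/
theorem infinite_of_large_solutions {S : ℤ → ℤ → Prop} {F : Set (ℝ × ℝ)} {a r : ℝ} (hr : 0 < r)
    (hF : ∀ x y : ℤ, S x y → (a, r * ((x : ℝ) ^ 2 + (y : ℝ) ^ 2)) ∈ F)
    (hS : ∀ n : ℕ, ∃ x y : ℤ, (n : ℤ) ≤ x ∧ 0 < y ∧ S x y) : {p ∈ F | p.1 ≤ p.2}.Infinite := by
  apply Set.Infinite.of_image Prod.snd
  apply Set.infinite_of_forall_exists_gt
  intro M
  obtain ⟨n, hn⟩ := exists_nat_gt (max (max a M / r) 1)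
  obtain ⟨x, y, hx, -, h⟩ := hS n
  have hxR : (n : ℝ) ≤ x := by exact_mod_cast hx
  have h1 : max a M / r < n := (le_max_left _ _).trans_lt hn
  have h2 : 1 < (n : ℝ) := (le_max_right _ _).trans_lt hn
  have h3 : max a M < r * ((x : ℝ) ^ 2 + (y : ℝ) ^ 2) := by
    rw [div_lt_iff₀' hr] at h1
    exact h1.trans_le (mul_le_mul_of_nonneg_left (by nlinarith [sq_nonneg (y : ℝ)]) hr.le)
  exact ⟨_, ⟨_, ⟨hF x y h, ((le_max_left _ _).trans_lt h3).le⟩, rfl⟩, (le_max_right _ _).trans_lt h3⟩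

/-- The substitution is multiplication of `y + x√5` by the norm-one unit `9 + 4√5`. The other
families use `2 + √3`, `55 + 12√21`, `3 + 2√2` and `5 + 2√6` in the same way. -/
theorem family1_infinite : {p ∈ family1 | p.1 ≤ p.2}.Infinite :=
  infinite_of_large_solutions (a := 3) (r := 3 / 2) (by norm_num)
    (fun x y h => ⟨x, y, h, rfl, by dsimp only; ring⟩)
    (exists_large_solution (f := fun x y => 9 * x + 4 * y) (g := fun x y => 20 * x + 9 * y)
      (x₀ := 0) (y₀ := 2) (by norm_num) (by norm_num) (by norm_num)
      fun x y hx hy h => ⟨by linear_combination h, by linarith, by linarith⟩)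

theorem family2_infinite : {p ∈ family2 | p.1 ≤ p.2}.Infinite :=
  infinite_of_large_solutions (a := 4) (r := 4) (by norm_num)
    (fun x y h => ⟨x, y, h, rfl, rfl⟩)
    (exists_large_solution (f := fun x y => 2 * x + y) (g := fun x y => 3 * x + 2 * y)
      (x₀ := 0) (y₀ := 1) (by norm_num) (by norm_num) (by norm_num)
      fun x y hx hy h => ⟨by linear_combination h, by linarith, by linarith⟩)

theorem family3_infinite : {p ∈ family3 | p.1 ≤ p.2}.Infinite :=
  infinite_of_large_solutions (a := 5) (r := 1 / 2) (by norm_num)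
    (fun x y h => ⟨x, y, h, rfl, by dsimp only; ring⟩)
    (exists_large_solution (f := fun x y => 55 * x + 36 * y) (g := fun x y => 84 * x + 55 * y)
      (x₀ := 1) (y₀ := 3) (by norm_num) (by norm_num) (by norm_num)
      fun x y hx hy h => ⟨by linear_combination h, by linarith, by linarith⟩)

theorem family4_infinite : {p ∈ family4 | p.1 ≤ p.2}.Infinite :=
  infinite_of_large_solutions (a := 6) (r := 3) (by norm_num)
    (fun x y h => ⟨x, y, h, rfl, rfl⟩)
    (exists_large_solution (f := fun x y => 3 * x + 2 * y) (g := fun x y => 4 * x + 3 * y)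
      (x₀ := 0) (y₀ := 1) (by norm_num) (by norm_num) (by norm_num)
      fun x y hx hy h => ⟨by linear_combination h, by linarith, by linarith⟩)

theorem family5_infinite : {p ∈ family5 | p.1 ≤ p.2}.Infinite :=
  infinite_of_large_solutions (a := 10) (r := 1) (by norm_num)
    (fun x y h => ⟨x, y, h, rfl, by dsimp only; ring⟩)
    (exists_large_solution (f := fun x y => 5 * x + 4 * y) (g := fun x y => 6 * x + 5 * y)
      (x₀ := 1) (y₀ := 2) (by norm_num) (by norm_num) (by norm_num)
      fun x y hx hy h => ⟨by linear_combination h, by linarith, by linarith⟩)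

theorem theorem1p3 :
    -- the shorter side is 3, 4, 5, 6 or 10
    (∀ (P : Fin 4 → Plane) (a b : ℝ), IsPythagoreanLEP P → HasSides P a b → a ≤ b →
      a = 3 ∨ a = 4 ∨ a = 5 ∨ a = 6 ∨ a = 10) ∧
    -- the side pairs with `a ≤ b` are exactly those given by the five families
    (∀ a b : ℝ, a ≤ b →
      ((a, b) ∈ pythagoreanSides ↔
        (a, b) ∈ family1 ∨ (a, b) ∈ family2 ∨ (a, b) ∈ family3 ∨ (a, b) ∈ family4 ∨
          (a, b) ∈ family5)) ∧
    -- every solution of each of the five equations gives a Pythagorean equable parallelogram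
    (family1 ⊆ pythagoreanSides ∧ family2 ⊆ pythagoreanSides ∧ family3 ⊆ pythagoreanSides ∧
      family4 ⊆ pythagoreanSides ∧ family5 ⊆ pythagoreanSides) ∧
    -- each family is infinite, also after restriction to `a ≤ b`
    ({p ∈ family1 | p.1 ≤ p.2}.Infinite ∧ {p ∈ family2 | p.1 ≤ p.2}.Infinite ∧
      {p ∈ family3 | p.1 ≤ p.2}.Infinite ∧ {p ∈ family4 | p.1 ≤ p.2}.Infinite ∧
      {p ∈ family5 | p.1 ≤ p.2}.Infinite) := by
  refine ⟨?_, ?_, ⟨fun p hp => ?_, fun p hp => ?_, fun p hp => ?_, fun p hp => ?_, fun p hp => ?_⟩,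
    family1_infinite, family2_infinite, family3_infinite, family4_infinite, family5_infinite⟩
  · intro P a b hP hs hab
    obtain ⟨t, c, rfl, rfl, h⟩ := hP.inFamilies hs hab
    have : t = 3 ∨ t = 4 ∨ t = 5 ∨ t = 6 ∨ t = 10 := by
      rcases h with ⟨_, _, _, h, _⟩ | ⟨_, _, _, h, _⟩ | ⟨_, _, _, h, _⟩ | ⟨_, _, _, h, _⟩ |
        ⟨_, _, _, h, _⟩ <;> simp [h]
    exact_mod_cast this
  · intro a b hab
    refine ⟨?_, mem_pythagoreanSides_of_mem_families⟩
    rintro ⟨P, hP, hs⟩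
    obtain ⟨t, c, rfl, rfl, h⟩ := hP.inFamilies hs hab
    exact mem_families_iff.1 h
  all_goals exact mem_pythagoreanSides_of_mem_families (by simp [hp])
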